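/- Fix a finite set $\mathbb A$ of labels. The path expressions $\alpha,\beta,\gamma$ and node expressions $\varphi,\psi$ of downward XPath with equality tests only are given by $$\alpha,\beta ::= \varepsilon \mid {\downarrow} \mid [\varphi] \mid \alpha\beta \mid \alpha\cup\beta,\qquad \varphi,\psi ::= a \mid \neg\varphi \mid \varphi\wedge\psi \mid \langle\alpha\rangle \mid \langle\alpha=\beta\rangle\quad(a\in\mathbb A).$$ Write $\varphi\vee\psi:=\neg(\neg\varphi\wedge\neg\psi)$, $\top:=\langle\varepsilon\rangle$, $\bot:=\neg\top$ for node expressions, and $\bot_{\mathrm p}:=[\neg\langle\varepsilon\rangle]$ for paths. A data tree is a rooted tree whose nodes are labelled by elements of $\mathbb A$, together with a partition of its set of nodes. Path expressions are interpreted as binary relations and node expressions as sets of nodes: $\varepsilon$ is the identity, ${\downarrow}$ the child relation, $[\varphi]$ the identity on the nodes satisfying $\varphi$, $\alpha\beta$ is composition, $\cup$ is union; $a$ holds at the nodes labelled $a$; Boolean operators are as usual; $\langle\alpha\rangle$ holds at $x$ if $(x,y)\in\alpha$ for some $y$; $\langle\alpha=\beta\rangle$ holds at $x$ if there are $y,z$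 in the same class of the partition with $(x,y)\in\alpha$ and $(x,z)\in\beta$. A node expression is satisfiable if it holds at the root of some data tree. Let $\mathsf{XP}^-$ be the set of all instances of the following equivalences, where $P\le Q$ stands for $P\vee Q\equiv Q$. * Labels: $\top\equiv\bigvee_{a\in\mathbb A}a$; $\bot\equiv a\wedge b$ for $a\ne b$. * Paths: $(\alpha[\neg\langle\beta\rangle])\beta\equiv\bot_{\mathrm p}$; $[\top]\equiv\varepsilon$; $[\varphi\vee\psi]\equiv[\varphi]\cup[\psi]$; $(\alpha\cup\beta)\cup\gamma\equiv\alpha\cup(\beta\cup\gamma)$; $\alpha\cup\beta\equiv\beta\cup\alpha$; $\alpha\cup\alpha\equiv\alpha$; $\alpha(\beta\gamma)\equiv(\alpha\beta)\gamma$; $\varepsilon\alpha\equiv\alpha$; $\alpha\varepsilon\equiv\alpha$; $\alpha(\beta\cup\gamma)\equiv(\alpha\beta)\cup(\alpha\gamma)$; $(\alpha\cup\beta)\gamma\equiv(\alpha\gamma)\cup(\beta\gamma)$; $\bot_{\mathrm p}\cup\alpha\equiv\alpha$. * Nodes: $\varphi\equiv\neg(\neg\varphi\vee\psi)\vee\neg(\neg\varphi\vee\neg\psi)$;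 $\langle[\varphi]\rangle\equiv\varphi$; $\langle\alpha\cup\beta\rangle\equiv\langle\alpha\rangle\vee\langle\beta\rangle$; $\langle\alpha\beta\rangle\equiv\langle\alpha[\langle\beta\rangle]\rangle$. * Equality: $\langle\alpha=\beta\rangle\equiv\langle\beta=\alpha\rangle$; $\langle\alpha\cup\beta=\gamma\rangle\equiv\langle\alpha=\gamma\rangle\vee\langle\beta=\gamma\rangle$; $\varphi\wedge\langle\alpha=\beta\rangle\equiv\langle[\varphi]\alpha=\beta\rangle$; $\langle\alpha=\beta\rangle\le\langle\alpha\rangle$; $\langle\gamma[\langle\alpha=\beta\rangle]\rangle\le\langle\gamma\alpha=\gamma\beta\rangle$; $\langle\alpha=\alpha\rangle\equiv\langle\alpha\rangle$; $\langle\alpha=\varepsilon\rangle\wedge\langle\beta=\varepsilon\rangle\le\langle\alpha=\beta\rangle$; $\langle\alpha=\beta[\langle\varepsilon=\gamma\rangle]\rangle\le\langle\alpha=\beta\gamma\rangle$. A node expression $\varphi$ is consistent if $\varphi\equiv\bot$ is not derivable from $\mathsf{XP}^-$ by the rules of equational logic (reflexivity, symmetry, transitivity, replacement of equivalents). Define sets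 of path expressions $P^-_n$, of data-aware diamonds $D^-_n$ and of node expressions $N^-_n$ by $$P^-_0=\{\varepsilon\},\qquad N^-_0=\{a\wedge\langle\varepsilon=\varepsilon\rangle : a\in\mathbb A\},\qquad P^-_{n+1}=\{\varepsilon\}\cup\{{\downarrow}[\psi]\beta : \psi\in N^-_n,\ \beta\in P^-_n\},$$ $$D^-_{n+1}=\{\langle\alpha=\beta\rangle : \alpha,\beta\in P^-_{n+1}\},$$ $$N^-_{n+1}=\Big\{a\wedge\bigwedge_{\varphi\in C}\varphi\wedge\bigwedge_{\varphi\in D^-_{n+1}\setminus C}\neg\varphi \;:\; C\subseteq D^-_{n+1},\ a\in\mathbb A\Big\}\cap\{\varphi : \varphi\text{ consistent}\},$$ where in each conjunction the conjuncts are taken in a fixed order. **Lemma.** For every $n\ge 0$, every node expression $\varphi\in N^-_n$ is satisfiable. -/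

import Mathlib

namespace EqXPath

universe u

mutual

/-- Node expressions of downward XPath with data equality tests only, over the label set `A`. -/
inductive NodeExpr (A : Type u) : Type u
  | label : A → NodeExpr A
  | neg : NodeExpr A → NodeExpr A
  | and : NodeExpr A → NodeExpr A → NodeExpr A
  | diam : PathExpr A → NodeExpr A
  | eq : PathExpr A → PathExpr A → NodeExpr A

/-- Path expressions of downward XPath with data equality tests only, over the label set `A`. -/
inductive PathExpr (A : Type u) : Type u
  | eps : PathExpr A
  | down : PathExpr A
  | test : NodeExpr A → PathExpr A
  | seq : PathExpr A → PathExpr A → PathExpr A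
  | union : PathExpr A → PathExpr A → PathExpr A

end

variable {A : Type u}

/-- `⊤ := ⟨ε⟩`. -/
def NodeExpr.top : NodeExpr A := .diam .eps

/-- `⊥ := ¬⟨ε⟩`. -/
def NodeExpr.bot : NodeExpr A := .neg .top

/-- `φ ∨ ψ := ¬(¬φ ∧ ¬ψ)`. -/
def NodeExpr.or (φ ψ : NodeExpr A) : NodeExpr A := .neg (.and (.neg φ) (.neg ψ))

/-- The path expression `⊥ := [¬⟨ε⟩]`. -/
def PathExpr.bot : PathExpr A := .test (.neg (.diam .eps))

/-- `φ ∧ ψ₁ ∧ ⋯ ∧ ψₖ` (associated to the left) for the list `[ψ₁, …, ψₖ]`. -/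
def NodeExpr.bigAnd (φ : NodeExpr A) (l : List (NodeExpr A)) : NodeExpr A :=
  l.foldl NodeExpr.and φ

/-- `ψ₁ ∨ ⋯ ∨ ψₖ` (associated to the left); the empty disjunction is `⊥`. -/
def NodeExpr.bigOr : List (NodeExpr A) → NodeExpr A
  | [] => .bot
  | φ :: l => l.foldl NodeExpr.or φ

/-! ### Data trees and semantics -/

/-- A data tree: a rooted tree given by its child relation (the root has no parent, every other
node has exactly one parent, and every node is reachable from the root), a label in `A` for every
node, and a partition of the nodes, given as an equivalence relation. The tree may be infinite. -/
structure DataTree (A : Type u) where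
  Node : Type
  root : Node
  child : Node → Node → Prop
  root_no_parent : ∀ x, ¬ child x root
  unique_parent : ∀ y, y ≠ root → ∃! x, child x y
  reachable : ∀ y, Relation.ReflTransGen child root y
  label : Node → A
  data : Setoid Node

mutual

/-- `T, x ⊨ φ`. -/
def NodeExpr.Sat (T : DataTree A) : NodeExpr A → T.Node → Prop
  | .label a, x => T.label x = a
  | .neg φ, x => ¬ NodeExpr.Sat T φ x
  | .and φ ψ, x => NodeExpr.Sat T φ x ∧ NodeExpr.Sat T ψ x
  | .diam α, x => ∃ y, PathExpr.Sat T α x y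
  | .eq α β, x => ∃ y z, PathExpr.Sat T α x y ∧ PathExpr.Sat T β x z ∧ T.data.r y z

/-- `T, x, y ⊨ α`. -/
def PathExpr.Sat (T : DataTree A) : PathExpr A → T.Node → T.Node → Prop
  | .eps, x, y => x = y
  | .down, x, y => T.child x y
  | .test φ, x, y => x = y ∧ NodeExpr.Sat T φ x
  | .seq α β, x, z => ∃ y, PathExpr.Sat T α x y ∧ PathExpr.Sat T β y z
  | .union α β, x, y => PathExpr.Sat T α x y ∨ PathExpr.Sat T β x y

end

/-- A node expression is satisfiable if it is true at the root of some data tree. -/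
def NodeExpr.Satisfiable (φ : NodeExpr A) : Prop :=
  ∃ T : DataTree A, φ.Sat T T.root

/-! ### The equational system -/

/-- The instances of the path schemes. -/
inductive PathAx : PathExpr A → PathExpr A → Prop
  | pred_neg (α β : PathExpr A) :
      PathAx (.seq (.seq α (.test (.neg (.diam β)))) β) .bot
  | pred_top : PathAx (.test .top) .eps
  | pred_or (φ ψ : NodeExpr A) :
      PathAx (.test (.or φ ψ)) (.union (.test φ) (.test ψ))
  | union_assoc (α β γ : PathExpr A) :
      PathAx (.union (.union α β) γ) (.union α (.union β γ))
  | union_comm (α β : PathExpr A) : PathAx (.union α β) (.union β α)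
  | union_idem (α : PathExpr A) : PathAx (.union α α) α
  | seq_assoc (α β γ : PathExpr A) :
      PathAx (.seq α (.seq β γ)) (.seq (.seq α β) γ)
  | eps_seq (α : PathExpr A) : PathAx (.seq .eps α) α
  | seq_eps (α : PathExpr A) : PathAx (.seq α .eps) α
  | seq_union (α β γ : PathExpr A) :
      PathAx (.seq α (.union β γ)) (.union (.seq α β) (.seq α γ))
  | union_seq (α β γ : PathExpr A) :
      PathAx (.seq (.union α β) γ) (.union (.seq α γ) (.seq β γ))
  | bot_union (α : PathExpr A) : PathAx (.union .bot α) α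

/-- The instances of the node schemes over the finite label set `A`. A scheme `φ ≤ ψ` stands for
`φ ∨ ψ ≡ ψ`. -/
inductive NodeAx [Fintype A] : NodeExpr A → NodeExpr A → Prop
  | label_or :
      NodeAx .top (.bigOr ((Finset.univ : Finset A).toList.map NodeExpr.label))
  | label_and (a b : A) (h : a ≠ b) : NodeAx .bot (.and (.label a) (.label b))
  | huntington (φ ψ : NodeExpr A) :
      NodeAx φ (.or (.neg (.or (.neg φ) ψ)) (.neg (.or (.neg φ) (.neg ψ))))
  | diam_test (φ : NodeExpr A) : NodeAx (.diam (.test φ)) φ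
  | diam_union (α β : PathExpr A) :
      NodeAx (.diam (.union α β)) (.or (.diam α) (.diam β))
  | diam_seq (α β : PathExpr A) :
      NodeAx (.diam (.seq α β)) (.diam (.seq α (.test (.diam β))))
  | eq_symm (α β : PathExpr A) : NodeAx (.eq α β) (.eq β α)
  | eq_union (α β γ : PathExpr A) :
      NodeAx (.eq (.union α β) γ) (.or (.eq α γ) (.eq β γ))
  | and_eq (φ : NodeExpr A) (α β : PathExpr A) :
      NodeAx (.and φ (.eq α β)) (.eq (.seq (.test φ) α) β)
  | eq_le_diam (α β : PathExpr A) :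
      NodeAx (.or (.eq α β) (.diam α)) (.diam α)
  | diam_eq_le (α β γ : PathExpr A) :
      NodeAx (.or (.diam (.seq γ (.test (.eq α β)))) (.eq (.seq γ α) (.seq γ β)))
        (.eq (.seq γ α) (.seq γ β))
  | eq_self (α : PathExpr A) : NodeAx (.eq α α) (.diam α)
  | eq_eps_le (α β : PathExpr A) :
      NodeAx (.or (.and (.eq α .eps) (.eq β .eps)) (.eq α β)) (.eq α β)
  | eq_test_le (α β γ : PathExpr A) :
      NodeAx (.or (.eq α (.seq β (.test (.eq .eps γ)))) (.eq α (.seq β γ)))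
        (.eq α (.seq β γ))

mutual

/-- Derivable node equivalences: the rules of equational logic, with the replacement rule given by
congruence for each of the constructors. -/
inductive NodeDer [Fintype A] : NodeExpr A → NodeExpr A → Prop
  | ax {φ ψ : NodeExpr A} : NodeAx φ ψ → NodeDer φ ψ
  | refl (φ : NodeExpr A) : NodeDer φ φ
  | symm {φ ψ : NodeExpr A} : NodeDer φ ψ → NodeDer ψ φ
  | trans {φ ψ ρ : NodeExpr A} : NodeDer φ ψ → NodeDer ψ ρ → NodeDer φ ρ
  | neg {φ φ' : NodeExpr A} : NodeDer φ φ' → NodeDer (.neg φ) (.neg φ')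
  | and {φ φ' ψ ψ' : NodeExpr A} :
      NodeDer φ φ' → NodeDer ψ ψ' → NodeDer (.and φ ψ) (.and φ' ψ')
  | diam {α α' : PathExpr A} : PathDer α α' → NodeDer (.diam α) (.diam α')
  | eq {α α' β β' : PathExpr A} :
      PathDer α α' → PathDer β β' → NodeDer (.eq α β) (.eq α' β')

/-- Derivable path equivalences. -/
inductive PathDer [Fintype A] : PathExpr A → PathExpr A → Prop
  | ax {α β : PathExpr A} : PathAx α β → PathDer α β
  | refl (α : PathExpr A) : PathDer α α
  | symm {α β : PathExpr A} : PathDer α β → PathDer β α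
  | trans {α β γ : PathExpr A} : PathDer α β → PathDer β γ → PathDer α γ
  | test {φ φ' : NodeExpr A} : NodeDer φ φ' → PathDer (.test φ) (.test φ')
  | seq {α α' β β' : PathExpr A} :
      PathDer α α' → PathDer β β' → PathDer (.seq α β) (.seq α' β')
  | union {α α' β β' : PathExpr A} :
      PathDer α α' → PathDer β β' → PathDer (.union α β) (.union α' β')

end

/-- A node expression is consistent if it is not provably equivalent to `⊥`. -/
def NodeExpr.Consistent [Fintype A] (φ : NodeExpr A) : Prop := ¬ NodeDer φ .bot

/-! ### Normal forms -/

open Classical in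
/-- `{ε} ∪ {↓[ψ]β | ψ ∈ N, β ∈ P}`. -/
noncomputable def pathForms (P : Finset (PathExpr A)) (N : Finset (NodeExpr A)) :
    Finset (PathExpr A) :=
  insert .eps (Finset.image₂ (fun ψ β => .seq .down (.seq (.test ψ) β)) N P)

open Classical in
/-- `{⟨α = β⟩ | α, β ∈ P}`. -/
noncomputable def diamForms (P : Finset (PathExpr A)) : Finset (NodeExpr A) :=
  Finset.image₂ NodeExpr.eq P P

open Classical in
/-- The conjunction of the label `a`, the elements of `C`, and the negations of the elements of
`D \ C`, each finite set being listed in one fixed order. -/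
noncomputable def conjForm (D : Finset (NodeExpr A)) (a : A) (C : Finset (NodeExpr A)) :
    NodeExpr A :=
  .bigAnd (.label a) (C.toList ++ (D \ C).toList.map NodeExpr.neg)

open Classical in
/-- The consistent conjunctions `conjForm D a C` with `a ∈ A` and `C ⊆ D`. -/
noncomputable def nodeForms [Fintype A] (D : Finset (NodeExpr A)) : Finset (NodeExpr A) :=
  (Finset.image₂ (conjForm D) Finset.univ D.powerset).filter NodeExpr.Consistent

open Classical in
/-- The path and node expressions in normal form at level `n`, by simultaneous recursion. -/
noncomputable def normalForms (A : Type u) [Fintype A] :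
    ℕ → Finset (PathExpr A) × Finset (NodeExpr A)
  | 0 => ({.eps}, Finset.univ.image fun a => .and (.label a) (.eq .eps .eps))
  | n + 1 =>
    let P := pathForms (normalForms A n).1 (normalForms A n).2
    (P, nodeForms (diamForms P))

/-- Path expressions in normal form at level `n`. -/
noncomputable def nfP (A : Type u) [Fintype A] (n : ℕ) : Finset (PathExpr A) :=
  (normalForms A n).1

/-- Data-aware diamonds at level `n`. -/
noncomputable def nfD (A : Type u) [Fintype A] (n : ℕ) : Finset (NodeExpr A) :=
  diamForms (nfP A n)

/-- Node expressions in normal form at level `n`. -/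
noncomputable def nfN (A : Type u) [Fintype A] (n : ℕ) : Finset (NodeExpr A) :=
  (normalForms A n).2

theorem mem_nfP_zero [Fintype A] {α : PathExpr A} : α ∈ nfP A 0 ↔ α = .eps := by
  simp [nfP, normalForms]

theorem mem_nfN_zero [Fintype A] {φ : NodeExpr A} :
    φ ∈ nfN A 0 ↔ ∃ a : A, φ = .and (.label a) (.eq .eps .eps) := by
  simp [nfN, normalForms, eq_comm]

theorem mem_nfP_succ [Fintype A] {n : ℕ} {α : PathExpr A} :
    α ∈ nfP A (n + 1) ↔
      α = .eps ∨ ∃ ψ ∈ nfN A n, ∃ β ∈ nfP A n, α = .seq .down (.seq (.test ψ) β) := by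
  simp [nfP, nfN, normalForms, pathForms, eq_comm]

theorem mem_nfD [Fintype A] {n : ℕ} {φ : NodeExpr A} :
    φ ∈ nfD A n ↔ ∃ α ∈ nfP A n, ∃ β ∈ nfP A n, φ = .eq α β := by
  simp [nfD, diamForms, eq_comm]

theorem mem_nfN_succ [Fintype A] {n : ℕ} {φ : NodeExpr A} :
    φ ∈ nfN A (n + 1) ↔
      (∃ a : A, ∃ C ⊆ nfD A (n + 1), φ = conjForm (nfD A (n + 1)) a C) ∧ φ.Consistent := by
  simp [nfP, nfD, nfN, normalForms, nodeForms, eq_comm]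

end EqXPath

namespace EqXPath

universe u

section Semantics

variable {A : Type u}

/-! ### Semantics of conjunctions and steps -/

theorem NodeExpr.sat_bigAnd {T : DataTree A} {x : T.Node} (l : List (NodeExpr A)) (φ : NodeExpr A) :
    (NodeExpr.bigAnd φ l).Sat T x ↔ φ.Sat T x ∧ ∀ ψ ∈ l, ψ.Sat T x := by
  induction l generalizing φ with
  | nil => simp [bigAnd]
  | cons ψ l ih =>
    have := ih (.and φ ψ)
    simp only [bigAnd, List.foldl_cons] at this ⊢
    simp [this, NodeExpr.Sat, and_assoc]

theorem sat_conjForm {T : DataTree A} {x : T.Node} {D C : Finset (NodeExpr A)} {a : A} :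
    (conjForm D a C).Sat T x ↔ T.label x = a ∧ (∀ χ ∈ C, χ.Sat T x) ∧
      ∀ χ ∈ D, χ ∉ C → ¬ χ.Sat T x := by
  simp only [conjForm, NodeExpr.sat_bigAnd, NodeExpr.Sat, List.mem_append, Finset.mem_toList,
    List.mem_map, Finset.mem_sdiff]
  refine and_congr_right fun _ => ⟨fun h => ⟨fun χ hχ => h χ (.inl hχ), fun χ hD hC => ?_⟩, ?_⟩
  · simpa only [NodeExpr.Sat] using h (.neg χ) (.inr ⟨χ, ⟨hD, hC⟩, rfl⟩)
  · rintro ⟨h, h'⟩ χ (hχ | ⟨χ, ⟨hD, hC⟩, rfl⟩)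
    · exact h χ hχ
    · simpa only [NodeExpr.Sat] using h' χ hD hC

/-- The path expression `↓[ψ]β`. -/
def PathExpr.step (ψ : NodeExpr A) (β : PathExpr A) : PathExpr A := .seq .down (.seq (.test ψ) β)

theorem PathExpr.sat_step {T : DataTree A} {ψ : NodeExpr A} {β : PathExpr A} {x z : T.Node} :
    (PathExpr.step ψ β).Sat T x z ↔ ∃ y, T.child x y ∧ ψ.Sat T y ∧ β.Sat T y z := by
  simp only [step, PathExpr.Sat]
  constructor
  · rintro ⟨y, h, _, ⟨rfl, h'⟩, h''⟩
    exact ⟨y, h, h', h''⟩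
  · rintro ⟨y, h, h', h''⟩
    exact ⟨y, h, y, ⟨rfl, h'⟩, h''⟩

/-- The one-node data tree. -/
def DataTree.single (a : A) : DataTree A where
  Node := Unit
  root := ()
  child _ _ := False
  root_no_parent _ h := h
  unique_parent _ h := absurd rfl h
  reachable _ := .refl
  label _ := a
  data := ⊤

/-! ### Invariance under generated subtrees -/

/-- An embedding of data trees onto the part generated by a node. -/
structure IsGeneratedEmbedding {T T' : DataTree A} (f : T.Node → T'.Node) : Prop where
  child_iff : ∀ x z, T'.child (f x) z ↔ ∃ y, z = f y ∧ T.child x y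
  label_eq : ∀ x, T'.label (f x) = T.label x
  data_iff : ∀ x y, T'.data.r (f x) (f y) ↔ T.data.r x y

mutual

theorem IsGeneratedEmbedding.sat_node_iff {T T' : DataTree A} {f : T.Node → T'.Node}
    (hf : IsGeneratedEmbedding f) : ∀ (φ : NodeExpr A) (x : T.Node),
      φ.Sat T' (f x) ↔ φ.Sat T x
  | .label a, x => by simp only [NodeExpr.Sat, hf.label_eq]
  | .neg φ, x => by simp only [NodeExpr.Sat, hf.sat_node_iff φ]
  | .and φ ψ, x => by simp only [NodeExpr.Sat, hf.sat_node_iff φ, hf.sat_node_iff ψ]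
  | .diam α, x => by
    simp only [NodeExpr.Sat, hf.sat_path_iff α]
    exact ⟨fun ⟨_, y, _, h⟩ => ⟨y, h⟩, fun ⟨y, h⟩ => ⟨f y, y, rfl, h⟩⟩
  | .eq α β, x => by
    simp only [NodeExpr.Sat, hf.sat_path_iff α, hf.sat_path_iff β]
    constructor
    · rintro ⟨_, _, ⟨y, rfl, hy⟩, ⟨z, rfl, hz⟩, h⟩
      exact ⟨y, z, hy, hz, (hf.data_iff y z).1 h⟩
    · rintro ⟨y, z, hy, hz, h⟩
      exact ⟨f y, f z, ⟨y, rfl, hy⟩, ⟨z, rfl, hz⟩, (hf.data_iff y z).2 h⟩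

theorem IsGeneratedEmbedding.sat_path_iff {T T' : DataTree A} {f : T.Node → T'.Node}
    (hf : IsGeneratedEmbedding f) : ∀ (α : PathExpr A) (x : T.Node) (z : T'.Node),
      α.Sat T' (f x) z ↔ ∃ y, z = f y ∧ α.Sat T x y
  | .eps, x, z => by
    simp only [PathExpr.Sat]
    exact ⟨fun h => ⟨x, h.symm, rfl⟩, fun ⟨y, h, h'⟩ => by rw [h, h']⟩
  | .down, x, z => by simp only [PathExpr.Sat, hf.child_iff]
  | .test φ, x, z => by
    simp only [PathExpr.Sat, hf.sat_node_iff φ]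
    exact ⟨fun ⟨h, h'⟩ => ⟨x, h.symm, rfl, h'⟩, fun ⟨y, h, h', h''⟩ => ⟨by rw [h, h'], h''⟩⟩
  | .seq α β, x, z => by
    simp only [PathExpr.Sat, hf.sat_path_iff α]
    constructor
    · rintro ⟨_, ⟨y, rfl, hy⟩, h⟩
      obtain ⟨w, rfl, hw⟩ := (hf.sat_path_iff β y z).1 h
      exact ⟨w, rfl, y, hy, hw⟩
    · rintro ⟨w, rfl, y, hy, hw⟩
      exact ⟨f y, ⟨y, rfl, hy⟩, (hf.sat_path_iff β y _).2 ⟨w, rfl, hw⟩⟩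
  | .union α β, x, z => by
    simp only [PathExpr.Sat, hf.sat_path_iff α, hf.sat_path_iff β, and_or_left, exists_or]

end

/-! ### Grafting data trees below a new root -/

section Graft

variable {I : Type} (F : I → DataTree A)

/-- The child relation of the grafted tree. -/
inductive GraftChild : Option (Σ i, (F i).Node) → Option (Σ i, (F i).Node) → Prop
  | root (i : I) : GraftChild none (some ⟨i, (F i).root⟩)
  | sub (i : I) (x y : (F i).Node) : (F i).child x y → GraftChild (some ⟨i, x⟩) (some ⟨i, y⟩)

variable (a : A) (p : ∀ i, (F i).Node) {K : Type u} (key : I → K) (k₀ : K)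

open Classical in
/-- The data value of a node of the grafted tree: the class of the marked node `p i` is sent to
`key i`, that of the root is `k₀`, and all other classes are kept apart. -/
noncomputable def graftValue : Option (Σ i, (F i).Node) → K ⊕ Σ i, Quotient (F i).data
  | none => .inl k₀
  | some ⟨i, y⟩ => if (F i).data.r (p i) y then .inl (key i) else .inr ⟨i, Quotient.mk _ y⟩

/-- The trees `F i` below a new root labelled `a`, the data class of `p i` being merged with the
classes of the `p j` with `key j = key i`, and with that of the root if `key i = k₀`. -/
noncomputable def graft : DataTree A where
  Node := Option (Σ i, (F i).Node)
  root := none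
  child := GraftChild F
  root_no_parent x h := by cases h
  unique_parent := by
    rintro (_ | ⟨i, y⟩) hy
    · exact absurd rfl hy
    · by_cases h : y = (F i).root
      · subst h
        refine ⟨none, .root i, ?_⟩
        rintro _ (_ | ⟨_, x, _, hx⟩)
        · rfl
        · exact absurd hx ((F i).root_no_parent x)
      · obtain ⟨x, hx, hu⟩ := (F i).unique_parent y h
        refine ⟨some ⟨i, x⟩, .sub i x y hx, ?_⟩
        rintro _ (_ | ⟨_, x', _, hx'⟩)
        · exact absurd rfl h
        · rw [hu x' hx']
  reachable := by
    rintro (_ | ⟨i, y⟩)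
    · exact .refl
    · refine .head (.root i) ?_
      exact Relation.ReflTransGen.lift (p := GraftChild F) (fun y => some ⟨i, y⟩)
        (fun x y h => .sub i x y h) _ _ ((F i).reachable y)
  label
    | none => a
    | some ⟨i, y⟩ => (F i).label y
  data := Setoid.ker (graftValue F p key k₀)

variable {F a p key k₀}

theorem graft_data_root_some {i : I} {y : (F i).Node} :
    (graft F a p key k₀).data.r none (some ⟨i, y⟩) ↔ (F i).data.r (p i) y ∧ key i = k₀ := by
  change graftValue F p key k₀ none = graftValue F p key k₀ (some ⟨i, y⟩) ↔ _
  by_cases h : (F i).data.r (p i) y <;> simp [graftValue, h, _root_.eq_comm]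

theorem graft_data_some_some {i j : I} {y : (F i).Node} {z : (F j).Node} (hij : i ≠ j) :
    (graft F a p key k₀).data.r (some ⟨i, y⟩) (some ⟨j, z⟩) ↔
      (F i).data.r (p i) y ∧ (F j).data.r (p j) z ∧ key i = key j := by
  change graftValue F p key k₀ (some ⟨i, y⟩) = graftValue F p key k₀ (some ⟨j, z⟩) ↔ _
  by_cases h : (F i).data.r (p i) y <;> by_cases h' : (F j).data.r (p j) z <;>
    simp [graftValue, h, h', hij]

theorem graft_data_same {i : I} {y z : (F i).Node} :
    (graft F a p key k₀).data.r (some ⟨i, y⟩) (some ⟨i, z⟩) ↔ (F i).data.r y z := by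
  change graftValue F p key k₀ (some ⟨i, y⟩) = graftValue F p key k₀ (some ⟨i, z⟩) ↔ _
  have hq : (Quotient.mk (F i).data y = Quotient.mk (F i).data z) ↔ (F i).data.r y z :=
    Quotient.eq
  by_cases h : (F i).data.r (p i) y <;> by_cases h' : (F i).data.r (p i) z
  · simpa [graftValue, h, h'] using (F i).data.trans ((F i).data.symm h) h'
  · simpa [graftValue, h, h'] using fun h'' => h' ((F i).data.trans h h'')
  · simpa [graftValue, h, h'] using fun h'' => h ((F i).data.trans h' ((F i).data.symm h''))
  · simpa [graftValue, h, h'] using hq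

theorem isGeneratedEmbedding_graft (i : I) :
    IsGeneratedEmbedding (T := F i) (T' := graft F a p key k₀) fun y => some ⟨i, y⟩ where
  child_iff x z := by
    constructor
    · rintro (_ | ⟨_, _, y, h⟩)
      exact ⟨y, rfl, h⟩
    · rintro ⟨y, rfl, h⟩
      exact .sub i x y h
  label_eq x := rfl
  data_iff x y := graft_data_same

end Graft

end Semantics

section Classes

variable (A : Type u) [Fintype A]

/-- Provable equivalence of node expressions. -/
def nodeSetoid : Setoid (NodeExpr A) := ⟨NodeDer, .refl, .symm, .trans⟩

/-- Provable equivalence of path expressions. -/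
def pathSetoid : Setoid (PathExpr A) := ⟨PathDer, .refl, .symm, .trans⟩

/-- Node expressions modulo provable equivalence. -/
def NodeCls : Type u := Quotient (nodeSetoid A)

/-- Path expressions modulo provable equivalence. -/
def PathCls : Type u := Quotient (pathSetoid A)

end Classes

variable {A : Type u} [Fintype A]

/-- The class of a node expression. -/
def NodeExpr.cls (φ : NodeExpr A) : NodeCls A := Quotient.mk (nodeSetoid A) φ

/-- The class of a path expression. -/
def PathExpr.cls (α : PathExpr A) : PathCls A := Quotient.mk (pathSetoid A) α

theorem NodeExpr.cls_eq {φ ψ : NodeExpr A} : φ.cls = ψ.cls ↔ NodeDer φ ψ :=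
  ⟨fun h => Quotient.exact (s := nodeSetoid A) h, fun h => Quotient.sound (s := nodeSetoid A) h⟩

theorem PathExpr.cls_eq_of_ax {α β : PathExpr A} (h : PathAx α β) : α.cls = β.cls :=
  Quotient.sound (s := pathSetoid A) (.ax h)

theorem NodeExpr.cls_eq_of_ax {φ ψ : NodeExpr A} (h : NodeAx φ ψ) : φ.cls = ψ.cls :=
  cls_eq.2 (.ax h)

theorem NodeCls.ind {p : NodeCls A → Prop} (h : ∀ φ : NodeExpr A, p φ.cls) (x : NodeCls A) : p x :=
  Quotient.ind h x

theorem PathCls.ind {p : PathCls A → Prop} (h : ∀ α : PathExpr A, p α.cls) (a : PathCls A) : p a :=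
  Quotient.ind h a

/-! ### Operations on classes -/

/-- The class of `φ ∨ ψ`. -/
def NodeCls.or : NodeCls A → NodeCls A → NodeCls A :=
  Quotient.map₂ NodeExpr.or fun _ _ h _ _ h' => .neg (.and (.neg h) (.neg h'))

/-- The class of `φ ∧ ψ`. -/
def NodeCls.and : NodeCls A → NodeCls A → NodeCls A :=
  Quotient.map₂ NodeExpr.and fun _ _ h _ _ h' => .and h h'

/-- The class of `α ∪ β`. -/
def PathCls.union : PathCls A → PathCls A → PathCls A :=
  Quotient.map₂ PathExpr.union fun _ _ h _ _ h' => .union h h'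

instance : Compl (NodeCls A) := ⟨Quotient.map NodeExpr.neg fun _ _ h => .neg h⟩

instance : Bot (NodeCls A) := ⟨NodeExpr.bot.cls⟩

instance : Top (NodeCls A) := ⟨NodeExpr.top.cls⟩

instance : Mul (PathCls A) := ⟨Quotient.map₂ PathExpr.seq fun _ _ h _ _ h' => .seq h h'⟩

instance : One (PathCls A) := ⟨PathExpr.eps.cls⟩

instance : Bot (PathCls A) := ⟨PathExpr.bot.cls⟩

/-- The class of `[φ]`. -/
def NodeCls.test : NodeCls A → PathCls A := Quotient.map PathExpr.test fun _ _ h => .test h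

/-- The class of `⟨α⟩`. -/
def PathCls.diam : PathCls A → NodeCls A := Quotient.map NodeExpr.diam fun _ _ h => .diam h

/-- The class of `⟨α = β⟩`. -/
def PathCls.eq : PathCls A → PathCls A → NodeCls A :=
  Quotient.map₂ NodeExpr.eq fun _ _ h _ _ h' => .eq h h'

theorem PathCls.diam_test (x : NodeCls A) : x.test.diam = x := by
  induction x using NodeCls.ind with | _ φ => exact NodeExpr.cls_eq_of_ax (.diam_test φ)

theorem NodeCls.test_injective : Function.Injective (NodeCls.test (A := A)) :=
  Function.LeftInverse.injective PathCls.diam_test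

theorem NodeCls.test_or (x y : NodeCls A) : (x.or y).test = x.test.union y.test := by
  induction x using NodeCls.ind with | _ φ =>
  induction y using NodeCls.ind with | _ ψ => exact PathExpr.cls_eq_of_ax (.pred_or φ ψ)

theorem PathCls.union_comm (a b : PathCls A) : a.union b = b.union a := by
  induction a using PathCls.ind with | _ α =>
  induction b using PathCls.ind with | _ β => exact PathExpr.cls_eq_of_ax (.union_comm α β)

theorem PathCls.union_assoc (a b c : PathCls A) : (a.union b).union c = a.union (b.union c) := by
  induction a using PathCls.ind with | _ α =>
  induction b using PathCls.ind with | _ β =>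
  induction c using PathCls.ind with | _ γ => exact PathExpr.cls_eq_of_ax (.union_assoc α β γ)

theorem PathCls.union_self (a : PathCls A) : a.union a = a := by
  induction a using PathCls.ind with | _ α => exact PathExpr.cls_eq_of_ax (.union_idem α)

theorem NodeCls.or_comm (x y : NodeCls A) : x.or y = y.or x :=
  test_injective <| by rw [test_or, test_or, PathCls.union_comm]

theorem NodeCls.or_assoc (x y z : NodeCls A) : (x.or y).or z = x.or (y.or z) :=
  test_injective <| by simp only [test_or, PathCls.union_assoc]

theorem NodeCls.or_self (x : NodeCls A) : x.or x = x :=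
  test_injective <| by rw [test_or, PathCls.union_self]

instance : SemilatticeSup (PathCls A) where
  le a b := a.union b = b
  le_refl := PathCls.union_self
  le_trans a b c h h' := by rw [← h', ← PathCls.union_assoc, h]
  le_antisymm a b h h' := by rw [← h', PathCls.union_comm, h]
  sup := PathCls.union
  le_sup_left a b := by rw [← PathCls.union_assoc, PathCls.union_self]
  le_sup_right a b := by rw [PathCls.union_comm a, ← PathCls.union_assoc, PathCls.union_self]
  sup_le a b c h h' := by rw [PathCls.union_assoc, h', h]

instance : SemilatticeSup (NodeCls A) where
  le x y := x.or y = y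
  le_refl := NodeCls.or_self
  le_trans x y z h h' := by rw [← h', ← NodeCls.or_assoc, h]
  le_antisymm x y h h' := by rw [← h', NodeCls.or_comm, h]
  sup := NodeCls.or
  le_sup_left x y := by rw [← NodeCls.or_assoc, NodeCls.or_self]
  le_sup_right x y := by rw [NodeCls.or_comm x, ← NodeCls.or_assoc, NodeCls.or_self]
  sup_le x y z h h' := by rw [NodeCls.or_assoc, h', h]

theorem NodeCls.test_sup (x y : NodeCls A) : (x ⊔ y).test = x.test ⊔ y.test := NodeCls.test_or x y

instance : OrderBot (PathCls A) where
  bot_le a := sup_eq_right.1 <| by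
    induction a using PathCls.ind with | _ α => exact PathExpr.cls_eq_of_ax (.bot_union α)

instance : Monoid (PathCls A) where
  mul_assoc a b c := by
    induction a using PathCls.ind with | _ α =>
    induction b using PathCls.ind with | _ β =>
    induction c using PathCls.ind with | _ γ =>
      exact (PathExpr.cls_eq_of_ax (.seq_assoc α β γ)).symm
  one_mul a := by
    induction a using PathCls.ind with | _ α => exact PathExpr.cls_eq_of_ax (.eps_seq α)
  mul_one a := by
    induction a using PathCls.ind with | _ α => exact PathExpr.cls_eq_of_ax (.seq_eps α)

theorem PathCls.mul_sup (a b c : PathCls A) : a * (b ⊔ c) = a * b ⊔ a * c := by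
  induction a using PathCls.ind with | _ α =>
  induction b using PathCls.ind with | _ β =>
  induction c using PathCls.ind with | _ γ => exact PathExpr.cls_eq_of_ax (.seq_union α β γ)

theorem PathCls.sup_mul (a b c : PathCls A) : (a ⊔ b) * c = a * c ⊔ b * c := by
  induction a using PathCls.ind with | _ α =>
  induction b using PathCls.ind with | _ β =>
  induction c using PathCls.ind with | _ γ => exact PathExpr.cls_eq_of_ax (.union_seq α β γ)

theorem PathCls.mul_mono {a a' b b' : PathCls A} (h : a ≤ a') (h' : b ≤ b') :
    a * b ≤ a' * b' := by
  refine le_trans (b := a' * b) ?_ ?_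
  · rw [← sup_eq_right, ← sup_mul, sup_eq_right.2 h]
  · rw [← sup_eq_right, ← mul_sup, sup_eq_right.2 h']

theorem NodeCls.test_mono {x y : NodeCls A} (h : x ≤ y) : x.test ≤ y.test := by
  rw [← sup_eq_right, ← test_sup, sup_eq_right.2 h]

theorem PathCls.diam_sup (a b : PathCls A) : (a ⊔ b).diam = a.diam ⊔ b.diam := by
  induction a using PathCls.ind with | _ α =>
  induction b using PathCls.ind with | _ β => exact NodeExpr.cls_eq_of_ax (.diam_union α β)

theorem PathCls.diam_mono {a b : PathCls A} (h : a ≤ b) : a.diam ≤ b.diam := by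
  rw [← sup_eq_right, ← diam_sup, sup_eq_right.2 h]

theorem PathCls.diam_bot : (⊥ : PathCls A).diam = ⊥ :=
  NodeExpr.cls_eq_of_ax (.diam_test NodeExpr.bot)

instance : OrderBot (NodeCls A) where
  bot_le x := by
    rw [← PathCls.diam_test x, ← PathCls.diam_bot]
    exact PathCls.diam_mono bot_le

/-! ### Boolean reasoning -/

namespace NodeCls

theorem huntington (x y : NodeCls A) : x = (xᶜ ⊔ y)ᶜ ⊔ (xᶜ ⊔ yᶜ)ᶜ := by
  induction x using NodeCls.ind with | _ φ =>
  induction y using NodeCls.ind with | _ ψ => exact NodeExpr.cls_eq_of_ax (.huntington φ ψ)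

theorem sup_compl_const (x y : NodeCls A) : x ⊔ xᶜ = y ⊔ yᶜ := by
  have h1 := huntington x yᶜ
  have h2 := huntington xᶜ yᶜ
  have h3 := huntington y xᶜ
  have h4 := huntington yᶜ xᶜ
  calc x ⊔ xᶜ = _ := congrArg₂ (· ⊔ ·) h1 h2
    _ = _ := by simp only [sup_comm, sup_left_comm]
    _ = y ⊔ yᶜ := (congrArg₂ (· ⊔ ·) h3 h4).symm

theorem sup_compl (x : NodeCls A) : x ⊔ xᶜ = ⊤ :=
  (sup_compl_const x ⊤).trans (sup_eq_left.2 (bot_le (a := (⊤ : NodeCls A))))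

theorem compl_top : (⊤ : NodeCls A)ᶜ = ⊥ := rfl

theorem compl_compl (x : NodeCls A) : xᶜᶜ = x := by
  have h := huntington x xᶜ
  rw [sup_idem, sup_compl, compl_top, sup_eq_left.2 bot_le] at h
  exact h.symm

theorem compl_le_compl {x y : NodeCls A} (h : x ≤ y) : yᶜ ≤ xᶜ := by
  have h' := huntington xᶜ y
  rw [compl_compl, sup_eq_right.2 h] at h'
  rw [h']
  exact le_sup_left

theorem le_compl_comm {x y : NodeCls A} (h : x ≤ yᶜ) : y ≤ xᶜ := by
  simpa only [compl_compl] using compl_le_compl h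

theorem compl_le_comm {x y : NodeCls A} (h : xᶜ ≤ y) : yᶜ ≤ x := by
  simpa only [compl_compl] using compl_le_compl h

theorem and_eq (x y : NodeCls A) : x.and y = (xᶜ ⊔ yᶜ)ᶜ := by
  rw [← compl_compl (x.and y), ← compl_compl x, ← compl_compl y, compl_compl xᶜ, compl_compl yᶜ]
  induction x using NodeCls.ind with | _ φ =>
  induction y using NodeCls.ind with | _ ψ => rfl

end NodeCls

instance : Lattice (NodeCls A) where
  inf := NodeCls.and
  inf_le_left x y := by
    rw [NodeCls.and_eq]
    exact NodeCls.compl_le_comm le_sup_left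
  inf_le_right x y := by
    rw [NodeCls.and_eq]
    exact NodeCls.compl_le_comm le_sup_right
  le_inf x y z h h' := by
    rw [NodeCls.and_eq]
    exact NodeCls.le_compl_comm (sup_le (NodeCls.compl_le_compl h) (NodeCls.compl_le_compl h'))

namespace NodeCls

theorem le_top' (x : NodeCls A) : x ≤ ⊤ := by
  rw [← sup_compl x]
  exact le_sup_left

theorem eq_bot_of_le_of_le_compl {x y : NodeCls A} (h : x ≤ y) (h' : x ≤ yᶜ) : x = ⊥ := by
  rw [← le_bot_iff, ← compl_top]
  apply le_compl_comm
  rw [← sup_compl y]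
  exact sup_le (le_compl_comm h') (compl_le_compl h)

theorem test_top : (⊤ : NodeCls A).test = 1 := PathExpr.cls_eq_of_ax .pred_top

theorem test_le_one (x : NodeCls A) : x.test ≤ 1 := by
  rw [← test_top]
  exact test_mono (le_top' x)

end NodeCls

/-! ### Derived laws -/

namespace PathCls

open NodeCls

theorem mul_test_compl_diam_mul (a b : PathCls A) : a * b.diamᶜ.test * b = ⊥ := by
  induction a using PathCls.ind with | _ α =>
  induction b using PathCls.ind with | _ β => exact PathExpr.cls_eq_of_ax (.pred_neg α β)

theorem test_mul_test_self (x : NodeCls A) : x.test * x.test = x.test := by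
  have h : x.test * xᶜ.test = ⊥ := by
    simpa only [diam_test, NodeCls.compl_compl, one_mul] using mul_test_compl_diam_mul 1 xᶜ.test
  calc x.test * x.test = x.test * x.test ⊔ x.test * xᶜ.test := by
        rw [h, sup_eq_left.2 bot_le]
    _ = x.test := by rw [← mul_sup, ← test_sup, sup_compl, test_top, mul_one]

theorem test_le_test_mul_test {x y : NodeCls A} (h : x ≤ y) : x.test ≤ x.test * y.test := by
  conv_lhs => rw [← test_mul_test_self]
  exact mul_mono le_rfl (test_mono h)

theorem diam_mul (a b : PathCls A) : (a * b).diam = (a * b.diam.test).diam := by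
  induction a using PathCls.ind with | _ α =>
  induction b using PathCls.ind with | _ β => exact NodeExpr.cls_eq_of_ax (.diam_seq α β)

theorem diam_mul_le (a b : PathCls A) : (a * b).diam ≤ a.diam := by
  rw [diam_mul]
  conv_rhs => rw [← mul_one a]
  exact diam_mono (mul_mono le_rfl (test_le_one _))

theorem diam_mul_test_mul_eq_bot {x : NodeCls A} {b : PathCls A} (h : x ≤ b.diamᶜ)
    (a : PathCls A) : (a * x.test * b).diam = ⊥ := by
  rw [← le_bot_iff, ← diam_bot, ← mul_test_compl_diam_mul a b]
  exact diam_mono (mul_mono (mul_mono le_rfl (test_mono h)) le_rfl)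

theorem eq_comm (a b : PathCls A) : a.eq b = b.eq a := by
  induction a using PathCls.ind with | _ α =>
  induction b using PathCls.ind with | _ β => exact NodeExpr.cls_eq_of_ax (.eq_symm α β)

theorem sup_eq_cls (a b c : PathCls A) : (a ⊔ b).eq c = a.eq c ⊔ b.eq c := by
  induction a using PathCls.ind with | _ α =>
  induction b using PathCls.ind with | _ β =>
  induction c using PathCls.ind with | _ γ => exact NodeExpr.cls_eq_of_ax (.eq_union α β γ)

theorem eq_mono_right {b c : PathCls A} (h : b ≤ c) (a : PathCls A) : a.eq b ≤ a.eq c := by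
  rw [eq_comm a b, eq_comm a c, ← sup_eq_right, ← sup_eq_cls, sup_eq_right.2 h]

theorem eq_le_diam (a b : PathCls A) : a.eq b ≤ a.diam := by
  rw [← sup_eq_right]
  induction a using PathCls.ind with | _ α =>
  induction b using PathCls.ind with | _ β => exact NodeExpr.cls_eq_of_ax (.eq_le_diam α β)

theorem eq_self (a : PathCls A) : a.eq a = a.diam := by
  induction a using PathCls.ind with | _ α => exact NodeExpr.cls_eq_of_ax (.eq_self α)

theorem diam_mul_test_eq_le (a b c : PathCls A) :
    (c * (a.eq b).test).diam ≤ (c * a).eq (c * b) := by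
  rw [← sup_eq_right]
  induction a using PathCls.ind with | _ α =>
  induction b using PathCls.ind with | _ β =>
  induction c using PathCls.ind with | _ γ => exact NodeExpr.cls_eq_of_ax (.diam_eq_le α β γ)

theorem eq_one_inf_eq_one_le (a b : PathCls A) : a.eq 1 ⊓ b.eq 1 ≤ a.eq b := by
  rw [← sup_eq_right]
  induction a using PathCls.ind with | _ α =>
  induction b using PathCls.ind with | _ β => exact NodeExpr.cls_eq_of_ax (.eq_eps_le α β)

theorem eq_mul_test_le (a b c : PathCls A) : a.eq (b * (PathCls.eq 1 c).test) ≤ a.eq (b * c) := by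
  rw [← sup_eq_right]
  induction a using PathCls.ind with | _ α =>
  induction b using PathCls.ind with | _ β =>
  induction c using PathCls.ind with | _ γ => exact NodeExpr.cls_eq_of_ax (.eq_test_le α β γ)

theorem diam_one : (1 : PathCls A).diam = ⊤ := rfl

theorem le_eq_one_one (x : NodeCls A) : x ≤ PathCls.eq 1 1 := by
  rw [eq_self, diam_one]
  exact le_top' x

theorem le_eq_mul_test_mul {x y : NodeCls A} {a b c : PathCls A} (hx : x ≤ (c * y.test).diam)
    (hy : y ≤ a.eq b) : x ≤ (c * y.test * a).eq (c * y.test * b) :=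
  calc x ≤ (c * y.test).diam := hx
    _ ≤ (c * y.test * (a.eq b).test).diam := by
        rw [mul_assoc]
        exact diam_mono (mul_mono le_rfl (test_le_test_mul_test hy))
    _ ≤ _ := diam_mul_test_eq_le a b _

/-- Over a node in `x`, whatever is equal in data to an endpoint of `a` reached through that node
is equal in data to an endpoint of `c` reached through it. -/
def Forces (x : NodeCls A) (a c : PathCls A) : Prop :=
  ∀ h k : PathCls A, h.eq (k * x.test * a) ≤ h.eq (k * x.test * c)

theorem forces_refl (x : NodeCls A) (a : PathCls A) : Forces x a a := fun _ _ => le_rfl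

theorem forces_one {x : NodeCls A} {c : PathCls A} (h : x ≤ PathCls.eq 1 c) : Forces x 1 c := by
  intro d k
  refine le_trans (eq_mono_right ?_ d) (eq_mul_test_le d (k * x.test) c)
  rw [mul_one, mul_assoc]
  exact mul_mono le_rfl (test_le_test_mul_test h)

theorem Forces.test_mul {x y : NodeCls A} {a c : PathCls A} (h : Forces y a c) (d : PathCls A) :
    Forces x (d * (y.test * a)) (d * (y.test * c)) := fun e k => by
  simpa only [mul_assoc] using h e (k * x.test * d)

end PathCls

/-! ### Conjunctions -/

theorem NodeExpr.cls_bigAnd_le (l : List (NodeExpr A)) (φ : NodeExpr A) :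
    (NodeExpr.bigAnd φ l).cls ≤ φ.cls ∧ ∀ ψ ∈ l, (NodeExpr.bigAnd φ l).cls ≤ ψ.cls := by
  induction l generalizing φ with
  | nil => simp [bigAnd]
  | cons ψ l ih =>
    obtain ⟨h, h'⟩ := ih (.and φ ψ)
    change (NodeExpr.bigAnd φ (ψ :: l)).cls ≤ φ.cls ⊓ ψ.cls at h
    exact ⟨h.trans inf_le_left, fun χ hχ => by
      rcases List.mem_cons.1 hχ with rfl | hχ
      · exact h.trans inf_le_right
      · exact h' χ hχ⟩

theorem cls_conjForm_le {D C : Finset (NodeExpr A)} {a : A} {χ : NodeExpr A} (h : χ ∈ C) :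
    (conjForm D a C).cls ≤ χ.cls :=
  (NodeExpr.cls_bigAnd_le _ _).2 _ (List.mem_append_left _ (Finset.mem_toList.2 h))

theorem cls_conjForm_le_compl {D C : Finset (NodeExpr A)} {a : A} {χ : NodeExpr A} (h : χ ∈ D)
    (h' : χ ∉ C) : (conjForm D a C).cls ≤ χ.clsᶜ := by
  classical
  refine (NodeExpr.cls_bigAnd_le _ _).2 (.neg χ) (List.mem_append_right _ (List.mem_map.2 ⟨χ, ?_, rfl⟩))
  simp [h, h']

theorem eq_of_sat_of_mem_nfN {n : ℕ} {φ ψ : NodeExpr A} (hφ : φ ∈ nfN A n) (hψ : ψ ∈ nfN A n)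
    {T : DataTree A} {x : T.Node} (h : φ.Sat T x) (h' : ψ.Sat T x) : φ = ψ := by
  cases n with
  | zero =>
    obtain ⟨a, rfl⟩ := mem_nfN_zero.1 hφ
    obtain ⟨b, rfl⟩ := mem_nfN_zero.1 hψ
    simp only [NodeExpr.Sat] at h h'
    rw [← h.1, ← h'.1]
  | succ n =>
    obtain ⟨⟨a, C, hC, rfl⟩, -⟩ := mem_nfN_succ.1 hφ
    obtain ⟨⟨b, C', hC', rfl⟩, -⟩ := mem_nfN_succ.1 hψ
    obtain ⟨rfl, h1, h2⟩ := sat_conjForm.1 h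
    obtain ⟨rfl, h3, h4⟩ := sat_conjForm.1 h'
    congr 1
    ext χ
    exact ⟨fun hχ => by_contra fun hn => h4 χ (hC hχ) hn (h1 χ hχ),
      fun hχ => by_contra fun hn => h2 χ (hC' hχ) hn (h3 χ hχ)⟩

/-! ### Realizing normal forms -/

open PathCls in
/-- The tree `T` is a model of `ψ` at level `n` in which only provable data equalities hold at the
root, and in which the endpoints of paths can be chosen with data classes as small as possible. -/
structure Realizes (n : ℕ) (ψ : NodeExpr A) (T : DataTree A) : Prop where
  sat : ψ.Sat T T.root
  le_of_sat : ∀ α ∈ nfP A n, ∀ β ∈ nfP A n, (NodeExpr.eq α β).Sat T T.root →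
    ψ.cls ≤ α.cls.eq β.cls
  isolated : ∀ α ∈ nfP A n, ψ.cls ≤ α.cls.diamᶜ ∨ ∃ y, α.Sat T T.root y ∧
    ∀ z, T.data.r y z → ∀ γ ∈ nfP A n, γ.Sat T T.root z → Forces ψ.cls α.cls γ.cls

open PathCls

theorem exists_realizes_zero {φ : NodeExpr A} (hφ : φ ∈ nfN A 0) :
    ∃ T : DataTree A, Realizes 0 φ T := by
  obtain ⟨a, rfl⟩ := mem_nfN_zero.1 hφ
  refine ⟨.single a, ⟨rfl, ⟨(), (), rfl, rfl, (DataTree.single a).data.refl _⟩⟩, ?_, ?_⟩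
  · intro α hα β hβ _
    rw [mem_nfP_zero.1 hα, mem_nfP_zero.1 hβ]
    exact le_eq_one_one _
  · intro α hα
    refine .inr ⟨(), ?_, fun z _ γ hγ _ => ?_⟩
    · rw [mem_nfP_zero.1 hα]
      rfl
    · rw [mem_nfP_zero.1 hα, mem_nfP_zero.1 hγ]
      exact forces_refl _ _

theorem eps_mem_nfP (n : ℕ) : (PathExpr.eps : PathExpr A) ∈ nfP A n := by
  cases n with
  | zero => exact mem_nfP_zero.2 rfl
  | succ n => exact mem_nfP_succ.2 (.inl rfl)

theorem PathExpr.cls_step (ψ : NodeExpr A) (β : PathExpr A) :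
    (PathExpr.step ψ β).cls = PathExpr.down.cls * (ψ.cls.test * β.cls) := rfl

/-- The prescribed endpoints for the children of the root in the tree for a normal form in `x`: a
path `↓[ψ]α` together with a path `β` to whose endpoint it has to be equal. -/
structure Demand (n : ℕ) (x : NodeCls A) where
  ψ : NodeExpr A
  α : PathExpr A
  β : PathExpr A
  ψ_mem : ψ ∈ nfN A n
  α_mem : α ∈ nfP A n
  β_mem : β ∈ nfP A (n + 1)
  le : x ≤ (PathExpr.step ψ α).cls.eq β.cls

namespace Demand

variable {n : ℕ} {x : NodeCls A}

instance : Finite (Demand n x) := by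
  refine Finite.of_injective (β := nfN A n × nfP A n × nfP A (n + 1))
    (fun d => (⟨d.ψ, d.ψ_mem⟩, ⟨d.α, d.α_mem⟩, ⟨d.β, d.β_mem⟩)) ?_
  rintro ⟨⟩ ⟨⟩ h
  simpa using h

/-- The path `↓[ψ]α` of a demand. -/
def path (d : Demand n x) : PathExpr A := PathExpr.step d.ψ d.α

theorem path_ne_eps (d : Demand n x) : d.path ≠ .eps := nofun

theorem ext_path {d e : Demand n x} (h : d.path = e.path) (h' : d.β = e.β) : d = e := by
  cases d
  cases e
  simp only [path, PathExpr.step, PathExpr.seq.injEq, PathExpr.test.injEq, true_and] at h h'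
  obtain ⟨rfl, rfl⟩ := h
  subst h'
  rfl

open Classical in
/-- Demands with the same key are to be met by the same data class; `s(ε, ε)` stands for the class
of the root. -/
noncomputable def key (d : Demand n x) : Sym2 (PathExpr A) :=
  if d.β = .eps then s(.eps, .eps) else s(d.path, d.β)

theorem key_eq_root {d : Demand n x} (h : d.key = s(.eps, .eps)) : d.β = .eps := by
  by_contra hβ
  simp only [key, hβ, if_false, Sym2.eq_iff] at h
  exact hβ (by tauto)

theorem key_eq_key {d e : Demand n x} (h : d.key = e.key) (hne : d ≠ e) :
    (d.β = .eps ∧ e.β = .eps) ∨ (d.β = e.path ∧ e.β = d.path) := by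
  by_cases hd : d.β = .eps
  · exact .inl ⟨hd, key_eq_root (by rw [← h, key, if_pos hd])⟩
  by_cases he : e.β = .eps
  · exact .inl ⟨key_eq_root (by rw [h, key, if_pos he]), he⟩
  simp only [key, hd, he, if_false, Sym2.eq_iff] at h
  rcases h with ⟨h, h'⟩ | ⟨h, h'⟩
  · exact absurd (ext_path h h') hne
  · exact .inr ⟨h', h.symm⟩

theorem le_diam (d : Demand n x) : x ≤ d.path.cls.diam := d.le.trans (eq_le_diam _ _)

theorem le_diam_step (d : Demand n x) : x ≤ (PathExpr.down.cls * d.ψ.cls.test).diam := by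
  refine d.le_diam.trans ?_
  rw [path, PathExpr.cls_step, ← mul_assoc]
  exact diam_mul_le _ _

theorem not_le_compl (hx : x ≠ ⊥) (d : Demand n x) : ¬ d.ψ.cls ≤ d.α.cls.diamᶜ := fun h => hx <| by
  rw [← le_bot_iff, ← diam_mul_test_mul_eq_bot h PathExpr.down.cls, mul_assoc]
  exact d.le_diam

end Demand

theorem exists_realizes_of_demands {n : ℕ} {x : NodeCls A} (hx : x ≠ ⊥) (a : A)
    (ih : ∀ ψ ∈ nfN A n, ∃ T : DataTree A, Realizes n ψ T) :
    ∃ T : DataTree A, T.label T.root = a ∧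
      (∀ α ∈ nfP A (n + 1), ∀ β ∈ nfP A (n + 1),
        ((NodeExpr.eq α β).Sat T T.root ↔ x ≤ α.cls.eq β.cls)) ∧
      ∀ α ∈ nfP A (n + 1), x ≤ α.cls.diam → ∃ y, α.Sat T T.root y ∧
        ∀ z, T.data.r y z → ∀ γ ∈ nfP A (n + 1), γ.Sat T T.root z →
          Forces x α.cls γ.cls := by
  obtain ⟨k, ⟨e⟩⟩ := Finite.exists_equiv_fin (Demand n x)
  let d : Fin k → Demand n x := fun i => e.symm i
  have hinj : Function.Injective d := e.symm.injective
  have hsurj : Function.Surjective d := e.symm.surjective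
  clear_value d
  choose F hF using fun i => ih (d i).ψ (d i).ψ_mem
  choose p hp hpf using fun i =>
    ((hF i).isolated _ (d i).α_mem).resolve_left ((d i).not_le_compl hx)
  set T := graft F a p (fun i => (d i).key) s(.eps, .eps)
  have hemb : ∀ i, IsGeneratedEmbedding (T := F i) (T' := T) fun y => some ⟨i, y⟩ :=
    fun i => isGeneratedEmbedding_graft i
  have hchild : ∀ i, T.child T.root (some ⟨i, (F i).root⟩) := fun i => .root i
  -- the paths leading from the root to a given node
  have hroot : ∀ α ∈ nfP A (n + 1), α.Sat T T.root none → α = .eps := by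
    intro α hα h
    rcases mem_nfP_succ.1 hα with rfl | ⟨ψ, hψ, β, hβ, rfl⟩
    · rfl
    · obtain ⟨_, ⟨i⟩ | _, -, h⟩ := PathExpr.sat_step.1 h
      obtain ⟨y, hy, -⟩ := ((hemb i).sat_path_iff β _ _).1 h
      cases hy
  have hsub : ∀ α ∈ nfP A (n + 1), ∀ i y, α.Sat T T.root (some ⟨i, y⟩) →
      ∃ β ∈ nfP A n, α = PathExpr.step (d i).ψ β ∧ β.Sat (F i) (F i).root y := by
    intro α hα i y h
    rcases mem_nfP_succ.1 hα with rfl | ⟨ψ, hψ, β, hβ, rfl⟩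
    · cases h
    · obtain ⟨_, ⟨j⟩ | _, hs, h⟩ := PathExpr.sat_step.1 h
      obtain ⟨y', hy, h⟩ := ((hemb j).sat_path_iff β _ _).1 h
      cases hy
      have hs' := ((hemb i).sat_node_iff ψ _).1 hs
      rw [eq_of_sat_of_mem_nfN hψ (d i).ψ_mem hs' (hF i).sat]
      exact ⟨β, hβ, rfl, h⟩
  have hstep : ∀ i β y, β.Sat (F i) (F i).root y →
      (PathExpr.step (d i).ψ β).Sat T T.root (some ⟨i, y⟩) := fun i β y h =>
    PathExpr.sat_step.2 ⟨_, hchild i, ((hemb i).sat_node_iff _ _).2 (hF i).sat,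
      ((hemb i).sat_path_iff β _ _).2 ⟨y, rfl, h⟩⟩
  -- an endpoint equal in data to a marked node inherits its equalities
  have hmark : ∀ i y β, β ∈ nfP A n → β.Sat (F i) (F i).root y → (F i).data.r (p i) y →
      ∀ c : PathCls A, c.eq (d i).path.cls ≤ c.eq (PathExpr.step (d i).ψ β).cls := by
    intro i y β hβ hs hr c
    have := hpf i y hr β hβ hs c PathExpr.down.cls
    rwa [mul_assoc, mul_assoc] at this
  have hle : ∀ i, x ≤ (d i).β.cls.eq (d i).path.cls := fun i => by
    rw [PathCls.eq_comm]
    exact (d i).le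
  have hrs : ∀ i y β, β ∈ nfP A n → β.Sat (F i) (F i).root y → T.data.r none (some ⟨i, y⟩) →
      x ≤ PathCls.eq 1 (PathExpr.step (d i).ψ β).cls := by
    intro i y β hβ hs hr
    obtain ⟨hr, hk⟩ := graft_data_root_some.1 hr
    refine le_trans ?_ (hmark i y β hβ hs hr 1)
    have := hle i
    rwa [Demand.key_eq_root hk] at this
  have key : ∀ y z, T.data.r y z → ∀ α ∈ nfP A (n + 1), ∀ β ∈ nfP A (n + 1),
      α.Sat T T.root y → β.Sat T T.root z → x ≤ α.cls.eq β.cls := by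
    rintro (_ | ⟨i, y⟩) (_ | ⟨j, z⟩) hr α hα β hβ hy hz
    · rw [hroot α hα hy, hroot β hβ hz]
      exact le_eq_one_one x
    · obtain ⟨β', hβ', rfl, hz'⟩ := hsub β hβ j z hz
      rw [hroot α hα hy]
      exact hrs j z β' hβ' hz' hr
    · obtain ⟨α', hα', rfl, hy'⟩ := hsub α hα i y hy
      rw [hroot β hβ hz, PathCls.eq_comm]
      exact hrs i y α' hα' hy' (T.data.symm hr)
    · obtain ⟨α', hα', rfl, hy'⟩ := hsub α hα i y hy
      obtain ⟨β', hβ', rfl, hz'⟩ := hsub β hβ j z hz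
      by_cases hij : i = j
      · subst hij
        have := (hF i).le_of_sat α' hα' β' hβ' ⟨y, z, hy', hz', graft_data_same.1 hr⟩
        simpa only [PathExpr.cls_step, mul_assoc] using le_eq_mul_test_mul (d i).le_diam_step this
      · obtain ⟨hri, hrj, hk⟩ := (graft_data_some_some hij).1 hr
        rcases Demand.key_eq_key hk (hinj.ne hij) with ⟨h, h'⟩ | ⟨h, -⟩
        · refine le_trans (le_inf ?_ ?_) (eq_one_inf_eq_one_le _ _)
          · rw [PathCls.eq_comm]
            refine le_trans ?_ (hmark i y α' hα' hy' hri 1)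
            have := hle i
            rwa [h] at this
          · rw [PathCls.eq_comm]
            refine le_trans ?_ (hmark j z β' hβ' hz' hrj 1)
            have := hle j
            rwa [h'] at this
        · refine le_trans ?_ (hmark j z β' hβ' hz' hrj _)
          rw [PathCls.eq_comm, ← h]
          refine le_trans (hle i) (hmark i y α' hα' hy' hri _)
  have hdem : ∀ ψ ∈ nfN A n, ∀ α ∈ nfP A n, ∀ β ∈ nfP A (n + 1),
      x ≤ (PathExpr.step ψ α).cls.eq β.cls → ∃ i, (d i).ψ = ψ ∧ (d i).α = α ∧ (d i).β = β := by
    intro ψ hψ α hα β hβ h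
    obtain ⟨i, hi⟩ := hsurj ⟨ψ, α, β, hψ, hα, hβ, h⟩
    exact ⟨i, by rw [hi], by rw [hi], by rw [hi]⟩
  have heps : ∀ ψ ∈ nfN A n, ∀ α ∈ nfP A n, x ≤ (PathExpr.step ψ α).cls.eq 1 →
      (NodeExpr.eq (PathExpr.step ψ α) .eps).Sat T T.root := by
    intro ψ hψ α hα h
    obtain ⟨i, rfl, rfl, hi⟩ := hdem ψ hψ α hα .eps (eps_mem_nfP _) h
    refine ⟨some ⟨i, p i⟩, none, hstep i _ _ (hp i), rfl, T.data.symm ?_⟩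
    exact graft_data_root_some.2 ⟨(F i).data.refl _, by rw [Demand.key, if_pos hi]⟩
  refine ⟨T, rfl, fun α hα β hβ => ⟨fun ⟨y, z, hy, hz, hr⟩ => key y z hr α hα β hβ hy hz,
    fun h => ?_⟩, fun α hα h => ?_⟩
  · rcases mem_nfP_succ.1 hα with rfl | ⟨ψ, hψ, α', hα', rfl⟩ <;>
      rcases mem_nfP_succ.1 hβ with rfl | ⟨ρ, hρ, β', hβ', rfl⟩
    · exact ⟨_, _, rfl, rfl, T.data.refl _⟩
    · rw [PathCls.eq_comm] at h
      obtain ⟨y, z, hy, hz, hr⟩ := heps ρ hρ β' hβ' h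
      exact ⟨z, y, hz, hy, T.data.symm hr⟩
    · exact heps ψ hψ α' hα' h
    · obtain ⟨i, hi1, hi2, hi3⟩ := hdem ψ hψ α' hα' _ hβ h
      have h' := h
      rw [PathCls.eq_comm] at h'
      obtain ⟨j, hj1, hj2, hj3⟩ := hdem ρ hρ β' hβ' _ hα h'
      refine ⟨some ⟨i, p i⟩, some ⟨j, p j⟩, ?_, ?_, ?_⟩
      · have := hstep i _ _ (hp i)
        rwa [hi1, hi2] at this
      · have := hstep j _ _ (hp j)
        rwa [hj1, hj2] at this
      · by_cases hij : i = j
        · subst hij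
          exact T.data.refl _
        · refine (graft_data_some_some hij).2 ⟨(F i).data.refl _, (F j).data.refl _, ?_⟩
          have hi : (d i).β = (d j).path := by rw [hi3, Demand.path, hj1, hj2]; rfl
          have hj : (d j).β = (d i).path := by rw [hj3, Demand.path, hi1, hi2]; rfl
          simp only [Demand.key, hi, hj, Demand.path_ne_eps, if_false, Sym2.eq_swap]
  · rcases mem_nfP_succ.1 hα with rfl | ⟨ψ, hψ, α', hα', rfl⟩
    · refine ⟨none, rfl, fun z hr γ hγ hz => forces_one ?_⟩
      exact key none z hr .eps hα γ hγ rfl hz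
    · rw [← PathCls.eq_self] at h
      obtain ⟨i, rfl, rfl, hi⟩ := hdem ψ hψ α' hα' _ hα h
      change (d i).β = (d i).path at hi
      refine ⟨some ⟨i, p i⟩, hstep i _ _ (hp i), ?_⟩
      rintro (_ | ⟨j, z⟩) hr γ hγ hz
      · have := (graft_data_root_some.1 (T.data.symm hr)).2
        exact absurd (hi.symm.trans (Demand.key_eq_root this)) (d i).path_ne_eps
      · have hij : i = j := by
          by_contra hij
          have hne := hinj.ne hij
          rcases Demand.key_eq_key ((graft_data_some_some hij).1 hr).2.2 hne with
            ⟨h, -⟩ | ⟨h, h'⟩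
          · exact (d i).path_ne_eps (hi.symm.trans h)
          · exact hne (Demand.ext_path (hi.symm.trans h) (hi.trans h'.symm))
        subst hij
        obtain ⟨γ', hγ', rfl, hz'⟩ := hsub γ hγ i z hz
        exact (hpf i z (graft_data_same.1 hr) γ' hγ' hz').test_mul PathExpr.down.cls

theorem exists_realizes (n : ℕ) (φ : NodeExpr A) (hφ : φ ∈ nfN A n) :
    ∃ T : DataTree A, Realizes n φ T := by
  induction n generalizing φ with
  | zero => exact exists_realizes_zero hφ
  | succ n ih =>
    obtain ⟨⟨a, C, hC, rfl⟩, hcons⟩ := mem_nfN_succ.1 hφ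
    have hx : (conjForm (nfD A (n + 1)) a C).cls ≠ ⊥ := fun h => hcons (NodeExpr.cls_eq.1 h)
    have hmem : ∀ α ∈ nfP A (n + 1), ∀ β ∈ nfP A (n + 1), (conjForm (nfD A (n + 1)) a C).cls ≤
        α.cls.eq β.cls → NodeExpr.eq α β ∈ C := fun α hα β hβ h => by_contra fun hn =>
      hx (NodeCls.eq_bot_of_le_of_le_compl h
        (cls_conjForm_le_compl (mem_nfD.2 ⟨α, hα, β, hβ, rfl⟩) hn))
    obtain ⟨T, hlabel, hsat, hiso⟩ := exists_realizes_of_demands hx a ih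
    refine ⟨T, sat_conjForm.2 ⟨hlabel, fun χ hχ => ?_, fun χ hχ hn h => hn ?_⟩,
      fun α hα β hβ => (hsat α hα β hβ).1, fun α hα => ?_⟩
    · obtain ⟨α, hα, β, hβ, rfl⟩ := mem_nfD.1 (hC hχ)
      exact (hsat α hα β hβ).2 (cls_conjForm_le hχ)
    · obtain ⟨α, hα, β, hβ, rfl⟩ := mem_nfD.1 hχ
      exact hmem α hα β hβ ((hsat α hα β hβ).1 h)
    · by_cases h : NodeExpr.eq α α ∈ C
      · refine .inr (hiso α hα ?_)
        rw [← PathCls.eq_self]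
        exact cls_conjForm_le h
      · left
        rw [← PathCls.eq_self]
        exact cls_conjForm_le_compl (mem_nfD.2 ⟨α, hα, α, hα, rfl⟩) h

end EqXPath

theorem lemma3p7 {A : Type*} [Fintype A] (n : ℕ) (φ : EqXPath.NodeExpr A)
    (hφ : φ ∈ EqXPath.nfN A n) : φ.Satisfiable :=
  let ⟨T, hT⟩ := EqXPath.exists_realizes n φ hφ
  ⟨T, hT.sat⟩
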